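/- Let $\mathbb P$ be a probability measure on $\mathbb R$ that is absolutely continuous with respect to Lebesgue measure, with a density that is log-concave and supported in $[0,\overline K]$ for some $\overline K>0$. Let $p\ge 2$ be real, let $n\ge 1$, and let $\mathbb E$ denote expectation when $K\sim\mathbb P$. For a vector of strikes $K_1\le\dots\le K_n$ in $\mathbb R$ let $$A_i=\{x\in\mathbb R:\ |x-K_i|<|x-K_j|\ \text{ for all } j\ne i\},\qquad 1\le i\le n,$$ be its Voronoi cells, that is, $A_i$ is the set of points $x$ for which $i$ is the unique minimizer of $j\mapsto|x-K_j|$. The modified Lloyd map sends $(K_i)_{1\le i\le n}$ to the vector $(K_i')_{1\le i\le n}$ with $$K_i'=\frac{\mathbb E\big[K\,|K-K_i|^{p-2}\mathbf 1_{K\in A_i}\big]}{\mathbb E\big[|K-K_i|^{p-2}\mathbf 1_{K\in A_i}\big]},\qquad 1\le i\le n,$$ (with $0^0=1$ when $p=2$), and is defined at those vectors for which none of the $n$ denominators vanishes. Then a vector $K_1\le\dots\le K_n$ solves the $L^p$ quantization problem, that is, minimizes $$\mathbb E\Big[\min_{1\le j\le n}|K-K_j|^p\Big]$$ over all real vectors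 $K_1\le\dots\le K_n$, if and only if it is a fixed point of the modified Lloyd map, that is, the map is defined at $(K_i)_{1\le i\le n}$ and $K_i'=K_i$ for every $i$. -/

import Mathlib

open MeasureTheory

/-- A nonnegative function `f` on the real line is log-concave:
`f x ^ a * f y ^ b ≤ f (a x + b y)` for all convex weights `a`, `b`. -/
def IsLogConcave (f : ℝ → ℝ) : Prop :=
  (∀ x, 0 ≤ f x) ∧
    ∀ x y a b : ℝ, 0 ≤ a → 0 ≤ b → a + b = 1 → f x ^ a * f y ^ b ≤ f (a * x + b * y)

/-- `P` is absolutely continuous with respect to Lebesgue measure, with a density that is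
log-concave and supported in `[0, Kbar]`. -/
def HasLogConcaveDensityOn (P : Measure ℝ) (Kbar : ℝ) : Prop :=
  ∃ f : ℝ → ℝ, Measurable f ∧ IsLogConcave f ∧ Function.support f ⊆ Set.Icc 0 Kbar ∧
    P = volume.withDensity (fun x => ENNReal.ofReal (f x))

/-- The average regret `E[min_j |K - K_j|^p]` of the strikes `k`, where `K` has law `P`. -/
noncomputable def averageRegret (P : Measure ℝ) (p : ℝ) {n : ℕ} (k : Fin n → ℝ) : ℝ :=
  ∫ x, ⨅ j, |x - k j| ^ p ∂P

/-- The strike vector `k` solves the `L^p` quantization problem: it is nondecreasing and minimizes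
the average regret among all nondecreasing vectors of `n` strikes. -/
def SolvesQuantization (P : Measure ℝ) (p : ℝ) {n : ℕ} (k : Fin n → ℝ) : Prop :=
  Monotone k ∧ ∀ k' : Fin n → ℝ, Monotone k' → averageRegret P p k ≤ averageRegret P p k'

/-- The Voronoi cell `A_i`: the points for which `i` is the (unique) nearest index,
`i = argmin_j |x - k j|`. It is empty if `k i` occurs twice in `k`; for pairwise distinct strikes
the cells cover the line except for finitely many midpoints. -/
def voronoiCell {n : ℕ} (k : Fin n → ℝ) (i : Fin n) : Set ℝ :=
  {x | ∀ j, j ≠ i → |x - k i| < |x - k j|}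

/-- `E[|K - K_i|^(p-2) 1_{A_i}]`, the denominator of the modified Lloyd map. -/
noncomputable def lloydWeight (P : Measure ℝ) (p : ℝ) {n : ℕ} (k : Fin n → ℝ) (i : Fin n) : ℝ :=
  ∫ x in voronoiCell k i, |x - k i| ^ (p - 2) ∂P

/-- The modified Lloyd map `K_i ↦ E[K |K - K_i|^(p-2) 1_{A_i}] / E[|K - K_i|^(p-2) 1_{A_i}]`.
It is meaningful where no denominator vanishes. -/
noncomputable def lloydMap (P : Measure ℝ) (p : ℝ) {n : ℕ} (k : Fin n → ℝ) : Fin n → ℝ :=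
  fun i => (∫ x in voronoiCell k i, x * |x - k i| ^ (p - 2) ∂P) / lloydWeight P p k i

/-- `k` is a fixed point of the modified Lloyd map: the map is defined at `k` (all denominators
are nonzero) and sends `k` to itself. -/
def IsLloydFixedPoint (P : Measure ℝ) (p : ℝ) {n : ℕ} (k : Fin n → ℝ) : Prop :=
  (∀ i, lloydWeight P p k i ≠ 0) ∧ Function.IsFixedPt (lloydMap P p) k

/-! A minimizer exists by compactness, and every minimizer is a fixed point by first-order
optimality, so it suffices that fixed points are unique (`IsLloydFixedPoint.le_of_logConcave`). Let
`k`, `l` be fixed points with `l ≤ k` false, and let `i` be the first index with the largest shift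
`h = l i - k i > 0`. Translating the `l`-cell back by `h` centres both `i`-cells at `k i`. By
maximality the translated cell is no larger on the right of `k i` and no smaller on the left. By
log-concavity, passing from `f y` to `f (y + h)` also shifts relative weight to the left. The signed
moments of both cells vanish, so these inequalities must be equalities a.e.; the choice of the first
index makes one strict on an interval. -/

/-! ### Log-concave functions -/

/-- The points `b` and `c` are convex combinations of `a` and `d` with swapped weights; multiply the
two log-concavity bounds. Where `f > 0`, this says that `f (y + h) / f y` is nonincreasing in `y`
for `h ≥ 0`. -/
theorem IsLogConcave.mul_le_mul_of_add_eq_add {f : ℝ → ℝ} (hf : IsLogConcave f) {a b c d : ℝ}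
    (hab : a ≤ b) (hbd : b ≤ d) (h : a + d = b + c) : f a * f d ≤ f b * f c := by
  rcases eq_or_lt_of_le (hab.trans hbd) with had | had
  · have hb : b = a := by linarith
    have hd : d = a := by linarith
    have hc : c = a := by linarith
    subst hb hc
    rw [hd]
  · have hT : 0 < d - a := sub_pos.2 had
    set s := (d - b) / (d - a) with hs
    set t := (b - a) / (d - a) with ht
    have hs0 : 0 ≤ s := div_nonneg (by linarith) hT.le
    have ht0 : 0 ≤ t := div_nonneg (by linarith) hT.le
    have hst : s + t = 1 := by rw [hs, ht]; field_simp; ring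
    have h1 := hf.2 a d s t hs0 ht0 hst
    have h2 := hf.2 a d t s ht0 hs0 (by linarith)
    have e1 : s * a + t * d = b := by rw [hs, ht]; field_simp; ring
    have e2 : t * a + s * d = c := by
      have : t * a + s * d = (s + t) * (a + d) - (s * a + t * d) := by ring
      rw [this, e1, hst]; linarith
    rw [e1] at h1
    rw [e2] at h2
    have ha := hf.1 a
    have hd := hf.1 d
    have ea : f a ^ s * f a ^ t = f a := by
      rw [← Real.rpow_add_of_nonneg ha hs0 ht0, hst, Real.rpow_one]
    have ed : f d ^ s * f d ^ t = f d := by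
      rw [← Real.rpow_add_of_nonneg hd hs0 ht0, hst, Real.rpow_one]
    calc f a * f d = (f a ^ s * f d ^ t) * (f a ^ t * f d ^ s) := by
          nth_rewrite 1 [← ea, ← ed]; ring
      _ ≤ f b * f c := mul_le_mul h1 h2 (by positivity) (hf.1 b)

theorem IsLogConcave.pos_of_mem_Icc {f : ℝ → ℝ} (hf : IsLogConcave f) {a b x : ℝ}
    (ha : 0 < f a) (hb : 0 < f b) (hx : x ∈ Set.Icc a b) : 0 < f x := by
  have h := hf.mul_le_mul_of_add_eq_add (c := a + b - x) hx.1 hx.2 (by ring)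
  exact pos_of_mul_pos_left ((mul_pos ha hb).trans_le h) (hf.1 _)

/-! ### Fixed points as vanishing signed moments -/

theorem integrable_of_continuous_of_ae_mem_Icc {P : Measure ℝ} [IsFiniteMeasure P] {a b : ℝ}
    (hP : ∀ᵐ x ∂P, x ∈ Set.Icc a b) {g : ℝ → ℝ} (hg : Continuous g) : Integrable g P := by
  have h : IntegrableOn g (Set.Icc a b) P := hg.integrableOn_Icc
  rwa [IntegrableOn, Measure.restrict_eq_self_of_ae_mem hP] at h

/-- The signed power `x ↦ sgn (x - c) * |x - c| ^ (p - 1)`, the derivative of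
`x ↦ |x - c| ^ p / p`. -/
noncomputable def signedPower (p c x : ℝ) : ℝ := (x - c) * |x - c| ^ (p - 2)

theorem continuous_abs_sub_rpow {q : ℝ} (hq : 0 ≤ q) (c : ℝ) :
    Continuous fun x : ℝ => |x - c| ^ q :=
  (continuous_abs.comp (continuous_id.sub continuous_const)).rpow_const fun _ => Or.inr hq

theorem continuous_signedPower {p : ℝ} (hp : 2 ≤ p) (c : ℝ) : Continuous (signedPower p c) :=
  (continuous_id.sub continuous_const).mul (continuous_abs_sub_rpow (sub_nonneg.2 hp) c)

theorem signedPower_pos {p c x : ℝ} (h : c < x) : 0 < signedPower p c x :=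
  mul_pos (sub_pos.2 h) (Real.rpow_pos_of_pos (abs_pos.2 (sub_pos.2 h).ne') _)

theorem signedPower_neg {p c x : ℝ} (h : x < c) : signedPower p c x < 0 :=
  mul_neg_of_neg_of_pos (sub_neg.2 h) (Real.rpow_pos_of_pos (abs_pos.2 (sub_neg.2 h).ne) _)

theorem signedPower_self (p c : ℝ) : signedPower p c c = 0 := by simp [signedPower]

theorem signedPower_add (p c x h : ℝ) : signedPower p (c + h) (x + h) = signedPower p c x := by
  simp [signedPower]

theorem measurableSet_voronoiCell {n : ℕ} (k : Fin n → ℝ) (i : Fin n) :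
    MeasurableSet (voronoiCell k i) := by
  have : voronoiCell k i = ⋂ j, ⋂ (_ : j ≠ i), {x | |x - k i| < |x - k j|} := by
    ext x; simp [voronoiCell]
  rw [this]
  refine MeasurableSet.iInter fun j => MeasurableSet.iInter fun _ => ?_
  exact (isOpen_lt (by fun_prop) (by fun_prop)).measurableSet

theorem lloydWeight_ne_zero_iff {P : Measure ℝ} [IsFiniteMeasure P] [NullSingletonClass P] {a b : ℝ}
    (hP : ∀ᵐ x ∂P, x ∈ Set.Icc a b) {p : ℝ} (hp : 2 ≤ p) {n : ℕ} (k : Fin n → ℝ) (i : Fin n) :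
    lloydWeight P p k i ≠ 0 ↔ P (voronoiCell k i) ≠ 0 := by
  have hint := integrable_of_continuous_of_ae_mem_Icc hP
    (continuous_abs_sub_rpow (sub_nonneg.2 hp) (k i))
  have hnn : 0 ≤ᵐ[P.restrict (voronoiCell k i)] fun x => |x - k i| ^ (p - 2) :=
    Filter.Eventually.of_forall fun x => Real.rpow_nonneg (abs_nonneg _) _
  have hpos := setIntegral_pos_iff_support_of_nonneg_ae hnn hint.integrableOn
  have hcongr : P (Function.support (fun x => |x - k i| ^ (p - 2)) ∩ voronoiCell k i) =
      P (voronoiCell k i) := by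
    refine measure_congr ?_
    filter_upwards [Measure.ae_ne P (k i)] with x hx
    refine propext ⟨fun h => h.2, fun h => ⟨?_, h⟩⟩
    exact (Real.rpow_pos_of_pos (abs_pos.2 (sub_ne_zero.2 hx)) _).ne'
  rw [hcongr] at hpos
  rw [pos_iff_ne_zero (a := P _)] at hpos
  rw [← hpos, lloydWeight]
  exact ⟨fun h => lt_of_le_of_ne (integral_nonneg_of_ae hnn) h.symm, fun h => h.ne'⟩

theorem isLloydFixedPoint_iff {P : Measure ℝ} [IsFiniteMeasure P] [NullSingletonClass P] {a b : ℝ}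
    (hP : ∀ᵐ x ∂P, x ∈ Set.Icc a b) {p : ℝ} (hp : 2 ≤ p) {n : ℕ} (k : Fin n → ℝ) :
    IsLloydFixedPoint P p k ↔ ∀ i, P (voronoiCell k i) ≠ 0 ∧
      ∫ x in voronoiCell k i, signedPower p (k i) x ∂P = 0 := by
  have hw := continuous_abs_sub_rpow (sub_nonneg.2 hp)
  have key : ∀ i, ∫ x in voronoiCell k i, signedPower p (k i) x ∂P =
      (∫ x in voronoiCell k i, x * |x - k i| ^ (p - 2) ∂P) - k i * lloydWeight P p k i := by
    intro i
    rw [lloydWeight, ← integral_const_mul, ← integral_sub]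
    · simp only [signedPower, sub_mul]
    · exact (integrable_of_continuous_of_ae_mem_Icc hP
        (continuous_id.mul (hw (k i)))).integrableOn
    · exact (integrable_of_continuous_of_ae_mem_Icc hP
        (continuous_const.mul (hw (k i)))).integrableOn
  simp only [IsLloydFixedPoint, Function.IsFixedPt, funext_iff, ← forall_and]
  refine forall_congr' fun i => ?_
  rw [← lloydWeight_ne_zero_iff hP hp, key]
  refine and_congr_right fun h => ?_
  rw [lloydMap, div_eq_iff h, sub_eq_zero]

theorem measure_pos_ne_zero_of_integral_eq_zero {ν : Measure ℝ} [NullSingletonClass ν] (hν : ν ≠ 0)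
    {g : ℝ → ℝ} {c : ℝ} (hg : Integrable g ν) (hgc : ∀ x, x ≠ c → g x ≠ 0)
    (h0 : ∫ x, g x ∂ν = 0) : ν {x | 0 < g x} ≠ 0 := by
  intro hz
  have hle : 0 ≤ᵐ[ν] fun x => - g x := by
    have : ∀ᵐ x ∂ν, ¬ 0 < g x := by simpa [ae_iff] using hz
    filter_upwards [this] with x hx
    simpa using hx
  have h1 := (integral_eq_zero_iff_of_nonneg_ae hle hg.neg).1 (by rw [integral_neg, h0, neg_zero])
  have h2 : ∀ᵐ x ∂ν, False := by
    filter_upwards [h1, Measure.ae_ne ν c] with x hx hxc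
    exact hgc x hxc (by simpa using hx)
  exact hν (by simpa using h2)

/-- A function that changes sign only at `c` and has zero mean on a non-null set charges both sides
of `c`. With `IsLogConcave.pos_of_mem_Icc` this makes the density positive at every strike of a
fixed point. -/
theorem voronoi_exists_pos {P : Measure ℝ} [IsFiniteMeasure P] [NullSingletonClass P] {a b : ℝ}
    (hP : ∀ᵐ x ∂P, x ∈ Set.Icc a b) {f : ℝ → ℝ} (hf : Measurable f)
    (hPf : P = volume.withDensity fun x => ENNReal.ofReal (f x)) {p : ℝ} (hp : 2 ≤ p) {c : ℝ}
    {A : Set ℝ} (hA : P A ≠ 0) (h0 : ∫ x in A, signedPower p c x ∂P = 0) :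
    (∃ x, c < x ∧ 0 < f x) ∧ ∃ x, x < c ∧ 0 < f x := by
  have hfpos : ∀ᵐ x ∂P, 0 < f x := by
    rw [hPf, ae_withDensity_iff hf.ennreal_ofReal]
    exact Filter.Eventually.of_forall fun x hx => by simpa using hx
  have hν : P.restrict A ≠ 0 := by simpa using hA
  have hint := (integrable_of_continuous_of_ae_mem_Icc hP
    (continuous_signedPower hp c)).integrableOn (s := A)
  have hne : ∀ x, x ≠ c → signedPower p c x ≠ 0 := fun x hx => by
    rcases lt_or_gt_of_ne hx with h | h
    exacts [(signedPower_neg h).ne, (signedPower_pos h).ne']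
  have ex : ∀ s : Set ℝ, P.restrict A s ≠ 0 → ∃ x ∈ s, 0 < f x := fun s hs => by
    by_contra! hcon
    refine hs ((ae_restrict_of_ae hfpos : ∀ᵐ x ∂P.restrict A, 0 < f x).mono ?_ |>
      fun h : ∀ᵐ x ∂P.restrict A, x ∉ s => by simpa [ae_iff] using h)
    exact fun x hx hxs => (hcon x hxs).not_gt hx
  constructor
  · obtain ⟨x, hx, hfx⟩ := ex _ (measure_pos_ne_zero_of_integral_eq_zero hν hint hne h0)
    refine ⟨x, lt_of_not_ge fun hxc => ?_, hfx⟩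
    rcases hxc.eq_or_lt with rfl | h
    · simp [signedPower_self] at hx
    · exact (signedPower_neg (p := p) h).not_gt hx
  · obtain ⟨x, hx, hfx⟩ := ex _ (measure_pos_ne_zero_of_integral_eq_zero hν hint.neg
      (fun x hx => neg_ne_zero.2 (hne x hx)) (by simpa [integral_neg] using h0))
    refine ⟨x, lt_of_not_ge fun hxc => ?_, hfx⟩
    have hx' : signedPower p c x < 0 := by simpa using hx
    rcases hxc.eq_or_lt with rfl | h
    · simp [signedPower_self] at hx'
    · exact (signedPower_pos (p := p) h).not_gt hx'

/-! ### Voronoi cells under translation -/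

theorem injective_of_measure_voronoiCell_ne_zero {P : Measure ℝ} {n : ℕ} {k : Fin n → ℝ}
    (h : ∀ i, P (voronoiCell k i) ≠ 0) : Function.Injective k := by
  intro i j hij
  by_contra hne
  obtain ⟨x, hx⟩ := nonempty_of_measure_ne_zero (h i)
  exact (hx j (Ne.symm hne)).ne (by rw [hij])

/-- The hypotheses give `l j - l i ≤ k j - k i`: relative to the centre, right neighbours are closer
in `l` than in `k`, or equally close. The next lemma uses the same inequality for left neighbours.
-/
theorem mem_voronoiCell_of_translate {n : ℕ} {k l : Fin n → ℝ} (hk : StrictMono k)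
    (hl : StrictMono l) {i : Fin n} {h : ℝ} (hi : l i = k i + h) (hle : ∀ j, l j ≤ k j + h) {y : ℝ}
    (hy : k i < y) (hB : y + h ∈ voronoiCell l i) : y ∈ voronoiCell k i := by
  intro j hj
  have hBj := hB j hj
  have h1 := hle j
  rw [abs_of_pos (by linarith)] at hBj ⊢
  rcases lt_or_gt_of_ne hj with hji | hji
  · have := hk hji
    rw [abs_of_pos (by linarith)]
    linarith
  · have := hl hji
    rw [lt_abs] at hBj ⊢
    rcases hBj with h2 | h2
    · linarith
    · right; linarith

theorem translate_mem_voronoiCell {n : ℕ} {k l : Fin n → ℝ} (hk : StrictMono k)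
    (hl : StrictMono l) {i : Fin n} {h : ℝ} (hi : l i = k i + h) (hle : ∀ j, l j ≤ k j + h) {y : ℝ}
    (hy : y < k i) (hA : y ∈ voronoiCell k i) : y + h ∈ voronoiCell l i := by
  intro j hj
  have hAj := hA j hj
  have h1 := hle j
  rw [abs_of_neg (by linarith)] at hAj ⊢
  rcases lt_or_gt_of_ne hj with hji | hji
  · have := hk hji
    rw [lt_abs] at hAj ⊢
    rcases hAj with h2 | h2
    · left; linarith
    · linarith
  · have := hl hji
    rw [abs_of_neg (by linarith)]
    linarith

theorem mem_voronoiCell_of_midpoint_lt {n : ℕ} {l : Fin n → ℝ} (hl : StrictMono l)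
    {i : Fin n} {x : ℝ} (hx : x < l i) (hmid : ∀ j < i, (l j + l i) / 2 < x) :
    x ∈ voronoiCell l i := by
  intro j hj
  rw [abs_of_neg (by linarith)]
  rcases lt_or_gt_of_ne hj with hji | hji
  · have := hmid j hji
    rw [lt_abs]; left; linarith
  · have := hl hji
    rw [abs_of_neg (by linarith)]
    linarith

/-- If the strikes `l` are to the right of `k` by at most `h > 0`, and `i` is the first index where
the shift is exactly `h`, then the left part of the `i`-th cell of `l`, shifted back by `h`,
exceeds the `i`-th cell of `k` by a set of positive mass. -/
theorem exists_Ioo_translate_voronoiCell {f : ℝ → ℝ} (hlc : IsLogConcave f)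
    (hbdd : BddBelow (Function.support f)) {n : ℕ} {k l : Fin n → ℝ} (hk : StrictMono k)
    (hl : StrictMono l) (hfk : ∀ i, 0 < f (k i)) (hfl : ∀ i, 0 < f (l i)) {i : Fin n} {h : ℝ} (hh : 0 < h)
    (hi : l i = k i + h) (hlt : ∀ j < i, l j < k j + h) :
    ∃ α β, α < β ∧ ∀ y ∈ Set.Ioo α β, y < k i ∧ y + h ∈ voronoiCell l i ∧ 0 < f (y + h) ∧
      (y ∉ voronoiCell k i ∨ f y = 0) := by
  by_cases h0 : (i : ℕ) = 0
  · have hnone : ∀ j, ¬ j < i := fun j hj => by have := Fin.lt_def.1 hj; omega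
    have hL : sInf (Function.support f) ≤ k i := csInf_le hbdd (hfk i).ne'
    -- The first cell has no left neighbour, so strictness comes from the left end of the support.
    refine ⟨sInf (Function.support f) - h, sInf (Function.support f), by linarith, ?_⟩
    rintro y ⟨hy1, hy2⟩
    refine ⟨by linarith, mem_voronoiCell_of_midpoint_lt hl (by linarith)
      fun j hj => absurd hj (hnone j), ?_, Or.inr ?_⟩
    · obtain ⟨z, hz, hzy⟩ := exists_lt_of_csInf_lt (s := Function.support f) ⟨k i, (hfk i).ne'⟩
        (show sInf (Function.support f) < y + h by linarith)
      exact hlc.pos_of_mem_Icc (lt_of_le_of_ne (hlc.1 z) (Ne.symm hz)) (hfl i)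
        ⟨hzy.le, by linarith⟩
    · by_contra hne
      exact notMem_of_lt_csInf hy2 hbdd hne
  · obtain ⟨i', hi'⟩ : ∃ i' : Fin n, (i' : ℕ) + 1 = i := ⟨⟨i - 1, by omega⟩, by simp; omega⟩
    have hi'lt : i' < i := Fin.lt_def.2 (by omega)
    have hlast : ∀ j < i, l j ≤ l i' := fun j hj =>
      hl.monotone (Fin.le_def.2 (by have := Fin.lt_def.1 hj; omega))
    have h1 := hlt i' hi'lt
    have h2 := hl hi'lt
    -- The left boundaries of the `l`-cell, moved back by `h`, and of the `k`-cell.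
    refine ⟨(k i + l i' - h) / 2, (k i + k i') / 2, by linarith, ?_⟩
    rintro y ⟨hy1, hy2⟩
    have h3 := hk hi'lt
    have hyk : y < k i := by linarith
    refine ⟨hyk, mem_voronoiCell_of_midpoint_lt hl (by linarith)
      fun j hj => ?_, ?_, Or.inl fun hA => ?_⟩
    · have := hlast j hj; linarith
    · exact hlc.pos_of_mem_Icc (hfl i') (hfl i) ⟨by linarith, by linarith⟩
    · have hAj := hA i' hi'lt.ne
      rw [abs_of_neg (by linarith), lt_abs] at hAj
      rcases hAj with h4 | h4 <;> linarith

/-! ### Comparison of two fixed points -/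

theorem setIntegral_withDensity_ofReal {P : Measure ℝ} {f : ℝ → ℝ} (hf : Measurable f)
    (hf0 : ∀ x, 0 ≤ f x) (hPf : P = volume.withDensity fun x => ENNReal.ofReal (f x)) {A : Set ℝ}
    (hA : MeasurableSet A) (g : ℝ → ℝ) :
    ∫ x in A, g x ∂P = ∫ x, f x * A.indicator g x := by
  rw [← integral_indicator hA, hPf, integral_withDensity_eq_integral_toReal_smul
    hf.ennreal_ofReal (Filter.Eventually.of_forall fun x => ENNReal.ofReal_lt_top)]
  simp only [ENNReal.toReal_ofReal (hf0 _), smul_eq_mul]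

theorem integrable_mul_indicator_of_withDensity {P : Measure ℝ} {f : ℝ → ℝ} (hf : Measurable f)
    (hf0 : ∀ x, 0 ≤ f x) (hPf : P = volume.withDensity fun x => ENNReal.ofReal (f x)) {A : Set ℝ}
    (hA : MeasurableSet A) {g : ℝ → ℝ} (hg : Integrable g P) :
    Integrable fun x => f x * A.indicator g x := by
  have h := hg.indicator hA
  rw [hPf, integrable_withDensity_iff_integrable_smul' hf.ennreal_ofReal
    (Filter.Eventually.of_forall fun x => ENNReal.ofReal_lt_top)] at h
  simpa only [ENNReal.toReal_ofReal (hf0 _), smul_eq_mul] using h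

theorem IsLloydFixedPoint.le_of_logConcave {P : Measure ℝ} [IsFiniteMeasure P]
    [NullSingletonClass P] {f : ℝ → ℝ} (hf : Measurable f) (hlc : IsLogConcave f)
    (hPf : P = volume.withDensity fun x => ENNReal.ofReal (f x)) {a b : ℝ}
    (hsupp : Function.support f ⊆ Set.Icc a b) (hP : ∀ᵐ x ∂P, x ∈ Set.Icc a b) {p : ℝ}
    (hp : 2 ≤ p) {n : ℕ} {k l : Fin n → ℝ} (hk : Monotone k) (hl : Monotone l)
    (hkfix : IsLloydFixedPoint P p k) (hlfix : IsLloydFixedPoint P p l) : l ≤ k := by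
  have density_pos : ∀ {m : Fin n → ℝ}, IsLloydFixedPoint P p m → ∀ i, 0 < f (m i) := by
    intro m hm i
    obtain ⟨hA, h0⟩ := (isLloydFixedPoint_iff hP hp m).1 hm i
    obtain ⟨⟨x, hx, hfx⟩, ⟨y, hy, hfy⟩⟩ := voronoi_exists_pos hP hf hPf hp hA h0
    exact hlc.pos_of_mem_Icc hfy hfx ⟨hy.le, hx.le⟩
  have strict : ∀ {m : Fin n → ℝ}, Monotone m → IsLloydFixedPoint P p m → StrictMono m :=
    fun hm hmf => hm.strictMono_of_injective
      (injective_of_measure_voronoiCell_ne_zero fun i =>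
        ((isLloydFixedPoint_iff hP hp _).1 hmf i).1)
  have hk' := strict hk hkfix
  have hl' := strict hl hlfix
  by_contra hcon
  obtain ⟨i₀, hi₀⟩ : ∃ i₀, k i₀ < l i₀ := by simpa [Pi.le_def] using hcon
  obtain ⟨m, -, hm⟩ := Finset.exists_max_image Finset.univ (fun i => l i - k i)
    ⟨i₀, Finset.mem_univ _⟩
  set h := l m - k m with hh_def
  obtain ⟨i, hi, himin⟩ := Finset.exists_min_image
    (Finset.univ.filter fun i => l i - k i = h) id ⟨m, by simp [hh_def]⟩
  have hi : l i = k i + h := by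
    have := (Finset.mem_filter.1 hi).2
    linarith
  have hh : 0 < h := by
    have := hm i₀ (Finset.mem_univ _)
    linarith
  have hle : ∀ j, l j ≤ k j + h := fun j => by
    have := hm j (Finset.mem_univ _)
    linarith
  have hlt : ∀ j < i, l j < k j + h := fun j hj => by
    refine lt_of_le_of_ne (hle j) fun he => hj.not_ge (himin j ?_)
    simp [he]
  have hfk := density_pos hkfix
  have hfl := density_pos hlfix
  obtain ⟨α, β, hαβ, hstrict⟩ := exists_Ioo_translate_voronoiCell hlc
    ((bddBelow_Icc).mono hsupp) hk' hl' hfk hfl hh hi hlt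
  have hmk := measurableSet_voronoiCell k i
  have hml := measurableSet_voronoiCell l i
  set U : ℝ → ℝ := fun x => f x * (voronoiCell k i).indicator (signedPower p (k i)) x with hU
  set V : ℝ → ℝ := fun x => f x * (voronoiCell l i).indicator (signedPower p (l i)) x with hV
  have hUint : Integrable U := integrable_mul_indicator_of_withDensity hf hlc.1 hPf hmk
    (integrable_of_continuous_of_ae_mem_Icc hP (continuous_signedPower hp _))
  have hVint : Integrable fun y => V (y + h) :=
    (integrable_mul_indicator_of_withDensity hf hlc.1 hPf hml
    (integrable_of_continuous_of_ae_mem_Icc hP (continuous_signedPower hp _))).comp_add_right h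
  have hU0 : ∫ y, U y = 0 := by
    rw [hU, ← setIntegral_withDensity_ofReal hf hlc.1 hPf hmk]
    exact ((isLloydFixedPoint_iff hP hp k).1 hkfix i).2
  have hV0 : ∫ y, V (y + h) = 0 := by
    rw [integral_add_right_eq_self V, hV, ← setIntegral_withDensity_ofReal hf hlc.1 hPf hml]
    exact ((isLloydFixedPoint_iff hP hp l).1 hlfix i).2
  have hvy : ∀ y, (voronoiCell l i).indicator (signedPower p (l i)) (y + h) =
      {y | y + h ∈ voronoiCell l i}.indicator (signedPower p (k i)) y := fun y => by
    by_cases hB : y + h ∈ voronoiCell l i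
    · rw [Set.indicator_of_mem hB, Set.indicator_of_mem (by exact hB), hi, signedPower_add]
    · rw [Set.indicator_of_notMem hB, Set.indicator_of_notMem (by exact hB)]
  -- The factors `f (l i)` and `f (k i)` make the densities `f y` and `f (y + h)` agree at `y = k
  -- i`, where the signed power changes sign.
  have hW0 : ∫ y, (f (l i) * U y - f (k i) * V (y + h)) = 0 := by
    rw [integral_sub (hUint.const_mul _) (hVint.const_mul _), integral_const_mul,
      integral_const_mul, hU0, hV0]
    ring
  have hWnn : ∀ y, 0 ≤ f (l i) * U y - f (k i) * V (y + h) := by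
    intro y
    simp only [hU, hV, hvy]
    rw [sub_nonneg, hi]
    have hfy := hlc.1 y
    have hfyh := hlc.1 (y + h)
    have hfki := hfk i
    have hfli := hfl i
    rw [hi] at hfli
    rcases lt_trichotomy y (k i) with hy | hy | hy
    · have hs := signedPower_neg (p := p) hy
      have hlog := hlc.mul_le_mul_of_add_eq_add (a := y) (b := k i) (c := y + h) (d := k i + h)
        hy.le (by linarith) (by ring)
      by_cases hA : y ∈ voronoiCell k i
      · have hB := translate_mem_voronoiCell hk' hl' hi hle hy hA
        rw [Set.indicator_of_mem hA, Set.indicator_of_mem (by exact hB)]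
        nlinarith
      · rw [Set.indicator_of_notMem hA, mul_zero, mul_zero]
        exact mul_nonpos_of_nonneg_of_nonpos hfki.le (mul_nonpos_of_nonneg_of_nonpos hfyh
          (Set.indicator_apply_nonpos fun _ => hs.le))
    · subst hy
      have hzero : ∀ s : Set ℝ, s.indicator (signedPower p (k i)) (k i) = 0 := fun s =>
        Set.indicator_apply_eq_zero.2 fun _ => signedPower_self p _
      simp only [hzero, mul_zero, le_refl]
    · have hs := signedPower_pos (p := p) hy
      have hlog := hlc.mul_le_mul_of_add_eq_add (a := k i) (b := y) (c := k i + h) (d := y + h)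
        hy.le (by linarith) (by ring)
      by_cases hB : y + h ∈ voronoiCell l i
      · have hA := mem_voronoiCell_of_translate hk' hl' hi hle hy hB
        rw [Set.indicator_of_mem hA, Set.indicator_of_mem (by exact hB)]
        nlinarith
      · rw [Set.indicator_of_notMem (by exact hB), mul_zero, mul_zero]
        exact mul_nonneg hfli.le (mul_nonneg hfy (Set.indicator_apply_nonneg fun _ => hs.le))
  have hpos := (integral_pos_iff_support_of_nonneg hWnn
    ((hUint.const_mul _).sub (hVint.const_mul _))).2 (by
      refine (measure_mono (s := Set.Ioo α β) ?_).trans_lt' (by simpa using hαβ)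
      intro y hy
      obtain ⟨hyk, hB, hfyh, hA⟩ := hstrict y hy
      have hs := signedPower_neg (p := p) hyk
      have hUy : U y = 0 := by
        rcases hA with hA | hA
        · simp only [hU, Set.indicator_of_notMem hA, mul_zero]
        · simp only [hU, hA, zero_mul]
      have hVy : V (y + h) < 0 := by
        simp only [hV, hvy]
        rw [Set.indicator_of_mem (by exact hB)]
        exact mul_neg_of_pos_of_neg hfyh hs
      have := mul_neg_of_pos_of_neg (hfk i) hVy
      simp only [Function.mem_support, hUy]
      linarith)
  exact hpos.ne' hW0

/-! ### Existence of a minimizer -/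

theorem continuous_iInf_abs_sub_rpow {n : ℕ} [NeZero n] {p : ℝ} (hp : 0 ≤ p) :
    Continuous (Function.uncurry fun (k : Fin n → ℝ) (x : ℝ) => ⨅ j, |x - k j| ^ p) := by
  have h : (Function.uncurry fun (k : Fin n → ℝ) (x : ℝ) => ⨅ j, |x - k j| ^ p) =
      fun q => Finset.univ.inf' Finset.univ_nonempty fun j => |q.2 - q.1 j| ^ p := by
    ext q
    rw [Finset.inf'_univ_eq_ciInf]
    rfl
  rw [h]
  refine Continuous.finset_inf'_apply _ fun j _ => ?_
  exact Continuous.rpow_const (by fun_prop) fun _ => Or.inr hp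

theorem integrable_iInf_abs_sub_rpow {P : Measure ℝ} [IsFiniteMeasure P] {a b : ℝ}
    (hP : ∀ᵐ x ∂P, x ∈ Set.Icc a b) {n : ℕ} [NeZero n] {p : ℝ} (hp : 0 ≤ p) (k : Fin n → ℝ) :
    Integrable (fun x => ⨅ j, |x - k j| ^ p) P :=
  integrable_of_continuous_of_ae_mem_Icc hP
    ((continuous_iInf_abs_sub_rpow hp).comp (continuous_const.prodMk continuous_id))

theorem iInf_abs_sub_rpow_le {n : ℕ} {p : ℝ} (k : Fin n → ℝ) (x : ℝ) (j : Fin n) :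
    ⨅ j, |x - k j| ^ p ≤ |x - k j| ^ p :=
  ciInf_le (Set.finite_range _).bddBelow j

theorem averageRegret_comp_equiv (P : Measure ℝ) (p : ℝ) {n : ℕ} (k : Fin n → ℝ)
    (σ : Equiv.Perm (Fin n)) : averageRegret P p (k ∘ σ) = averageRegret P p k := by
  unfold averageRegret
  congr with x
  exact σ.iInf_comp (g := fun j => |x - k j| ^ p)

theorem SolvesQuantization.averageRegret_le {P : Measure ℝ} {p : ℝ} {n : ℕ} {k : Fin n → ℝ}
    (hk : SolvesQuantization P p k) (k' : Fin n → ℝ) :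
    averageRegret P p k ≤ averageRegret P p k' := by
  rw [← averageRegret_comp_equiv P p k' (Tuple.sort k')]
  exact hk.2 _ (Tuple.monotone_sort k')

theorem exists_solvesQuantization {P : Measure ℝ} [IsFiniteMeasure P] {a b : ℝ} (hab : a ≤ b)
    (hP : ∀ᵐ x ∂P, x ∈ Set.Icc a b) {n : ℕ} [NeZero n] {p : ℝ} (hp : 0 ≤ p) :
    ∃ k : Fin n → ℝ, SolvesQuantization P p k := by
  have hcont : Continuous fun k : Fin n → ℝ => averageRegret P p k := by
    have h := continuous_parametric_integral_of_continuous (μ := P)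
      (continuous_iInf_abs_sub_rpow (n := n) hp) (isCompact_Icc (a := a) (b := b))
    rwa [Measure.restrict_eq_self_of_ae_mem hP] at h
  obtain ⟨m, -, hm⟩ := (isCompact_Icc (a := fun _ : Fin n => a) (b := fun _ => b)).exists_isMinOn
    ⟨fun _ => a, le_rfl, fun _ => hab⟩ hcont.continuousOn
  refine ⟨m ∘ Tuple.sort m, Tuple.monotone_sort m, fun k' _ => ?_⟩
  rw [averageRegret_comp_equiv]
  -- Clamping strikes to `[a, b]` is 1-Lipschitz and fixes almost every `x`, so it does not increase
  -- the regret; minimizing over the compact box is enough.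
  have h1 : averageRegret P p m ≤ averageRegret P p fun j => max a (min b (k' j)) :=
    hm ⟨fun j => le_max_left _ _, fun j => max_le hab (min_le_left _ _)⟩
  refine h1.trans (integral_mono_ae (integrable_iInf_abs_sub_rpow hP hp _)
    (integrable_iInf_abs_sub_rpow hP hp _) ?_)
  filter_upwards [hP] with x hx
  refine ciInf_mono (Set.finite_range _).bddBelow fun j => ?_
  refine Real.rpow_le_rpow (abs_nonneg _) ?_ hp
  have hx' : x = max a (min b x) := by rw [min_eq_right hx.2, max_eq_right hx.1]
  calc |x - max a (min b (k' j))| = |max a (min b x) - max a (min b (k' j))| := by rw [← hx']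
    _ ≤ |min b x - min b (k' j)| := by
      simpa using abs_max_sub_max_le_max a (min b x) a (min b (k' j))
    _ ≤ |x - k' j| := by simpa using abs_min_sub_min_le_max b x b (k' j)

/-! ### Minimizers are fixed points -/

theorem iInf_update_le_of_notMem_voronoiCell {n : ℕ} [NeZero n] {p : ℝ} (hp : 0 ≤ p)
    {k : Fin n → ℝ} {i : Fin n} {x : ℝ} (hx : x ∉ voronoiCell k i) (y : ℝ) :
    ⨅ j, |x - Function.update k i y j| ^ p ≤ ⨅ j, |x - k j| ^ p := by
  obtain ⟨j', hj', hle⟩ : ∃ j, j ≠ i ∧ |x - k j| ≤ |x - k i| := by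
    simpa [voronoiCell] using hx
  have hne : ∀ j, j ≠ i → ⨅ j, |x - Function.update k i y j| ^ p ≤ |x - k j| ^ p := fun j hj => by
    simpa [hj] using iInf_abs_sub_rpow_le (p := p) (Function.update k i y) x j
  refine le_ciInf fun j => ?_
  rcases eq_or_ne j i with rfl | hj
  · exact (hne j' hj').trans (Real.rpow_le_rpow (abs_nonneg _) hle hp)
  · exact hne j hj

theorem iInf_eq_of_mem_voronoiCell {n : ℕ} [NeZero n] {p : ℝ} (hp : 0 ≤ p)
    {k : Fin n → ℝ} {i : Fin n} {x : ℝ} (hx : x ∈ voronoiCell k i) :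
    ⨅ j, |x - k j| ^ p = |x - k i| ^ p := by
  refine le_antisymm (iInf_abs_sub_rpow_le k x i) (le_ciInf fun j => ?_)
  rcases eq_or_ne j i with rfl | hj
  · exact le_rfl
  · exact Real.rpow_le_rpow (abs_nonneg _) (hx j hj).le hp

/-- A strike with a null cell is idle: moving it to a point `x₀` near which `P` has mass, away from
all strikes, strictly lowers the regret. -/
theorem SolvesQuantization.measure_voronoiCell_ne_zero {P : Measure ℝ} [IsFiniteMeasure P]
    [NullSingletonClass P] (hP0 : P ≠ 0) {a b : ℝ} (hP : ∀ᵐ x ∂P, x ∈ Set.Icc a b) {n : ℕ}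
    [NeZero n] {p : ℝ} (hp : 0 < p) {k : Fin n → ℝ} (hk : SolvesQuantization P p k) (i : Fin n) :
    P (voronoiCell k i) ≠ 0 := by
  intro hzero
  have hrange : P (Set.range k)ᶜ ≠ 0 := by
    rw [measure_compl (Set.finite_range k).measurableSet (measure_ne_top _ _),
      (Set.finite_range k).measure_zero, tsub_zero]
    simpa using hP0
  obtain ⟨x₀, hx₀, hnhds⟩ := exists_mem_forall_mem_nhdsWithin_pos_measure hrange
  have hle : ∀ᵐ x ∂P, ⨅ j, |x - Function.update k i x₀ j| ^ p ≤ ⨅ j, |x - k j| ^ p := by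
    have : ∀ᵐ x ∂P, x ∉ voronoiCell k i := by simpa [ae_iff] using hzero
    exact this.mono fun x hx => iInf_update_le_of_notMem_voronoiCell hp.le hx x₀
  set s : Set ℝ := {x | ∀ j, |x - x₀| < |x - k j|} with hs
  have hsopen : IsOpen s := by
    have : s = ⋂ j, {x | |x - x₀| < |x - k j|} := by ext x; simp [hs]
    rw [this]
    exact isOpen_iInter_of_finite fun j => isOpen_lt (by fun_prop) (by fun_prop)
  have hspos : 0 < P s := by
    refine hnhds s (mem_nhdsWithin_of_mem_nhds (hsopen.mem_nhds fun j => ?_))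
    rw [sub_self, abs_zero, abs_pos, sub_ne_zero]
    exact fun h => hx₀ ⟨j, h.symm⟩
  have hint := integrable_iInf_abs_sub_rpow hP (n := n) hp.le
  have hlt : 0 < ∫ x, ((⨅ j, |x - k j| ^ p) - ⨅ j, |x - Function.update k i x₀ j| ^ p) ∂P := by
    rw [integral_pos_iff_support_of_nonneg_ae (hle.mono fun x hx => sub_nonneg.2 hx)
      ((hint _).sub (hint _))]
    refine hspos.trans_le (measure_mono fun x hx => ?_)
    obtain ⟨j, hj⟩ := exists_eq_ciInf_of_finite (f := fun j => |x - k j| ^ p)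
    have h1 : ⨅ j, |x - Function.update k i x₀ j| ^ p ≤ |x - x₀| ^ p := by
      simpa using iInf_abs_sub_rpow_le (p := p) (Function.update k i x₀) x i
    have h2 : |x - x₀| ^ p < |x - k j| ^ p := Real.rpow_lt_rpow (abs_nonneg _) (hx j) hp
    simp only [Function.mem_support, ← hj]
    linarith
  rw [integral_sub (hint _) (hint _)] at hlt
  exact (sub_pos.1 hlt).not_ge (hk.averageRegret_le _)

/-- Move strike `i` to `y` but keep the old cell: off the cell some other strike is at least as
close, so nothing is lost there. Thus the cell need not be differentiated in the first-order
condition. -/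
theorem SolvesQuantization.setIntegral_voronoiCell_le {P : Measure ℝ} [IsFiniteMeasure P]
    {a b : ℝ} (hP : ∀ᵐ x ∂P, x ∈ Set.Icc a b) {n : ℕ} [NeZero n] {p : ℝ} (hp : 0 ≤ p)
    {k : Fin n → ℝ} (hk : SolvesQuantization P p k) (i : Fin n) (y : ℝ) :
    ∫ x in voronoiCell k i, |x - k i| ^ p ∂P ≤ ∫ x in voronoiCell k i, |x - y| ^ p ∂P := by
  have hA := measurableSet_voronoiCell k i
  have hint := integrable_iInf_abs_sub_rpow hP (n := n) hp
  have h := hk.averageRegret_le (Function.update k i y)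
  simp only [averageRegret] at h
  rw [← integral_add_compl hA (hint k), ← integral_add_compl hA (hint (Function.update k i y))] at h
  have h1 : ∫ x in voronoiCell k i, ⨅ j, |x - k j| ^ p ∂P =
      ∫ x in voronoiCell k i, |x - k i| ^ p ∂P :=
    setIntegral_congr_fun hA fun x hx => iInf_eq_of_mem_voronoiCell hp hx
  have h2 : ∫ x in voronoiCell k i, ⨅ j, |x - Function.update k i y j| ^ p ∂P ≤
      ∫ x in voronoiCell k i, |x - y| ^ p ∂P := by
    refine setIntegral_mono (hint _).integrableOn (integrable_of_continuous_of_ae_mem_Icc hP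
      (continuous_abs_sub_rpow hp y)).integrableOn fun x => ?_
    simpa using iInf_abs_sub_rpow_le (p := p) (Function.update k i y) x i
  have h3 : ∫ x in (voronoiCell k i)ᶜ, ⨅ j, |x - Function.update k i y j| ^ p ∂P ≤
      ∫ x in (voronoiCell k i)ᶜ, ⨅ j, |x - k j| ^ p ∂P :=
    setIntegral_mono_on (hint _).integrableOn (hint _).integrableOn hA.compl
      fun x hx => iInf_update_le_of_notMem_voronoiCell hp hx y
  linarith

theorem hasDerivAt_integral_abs_sub_rpow {P : Measure ℝ} [IsFiniteMeasure P] {a b : ℝ}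
    (hP : ∀ᵐ x ∂P, x ∈ Set.Icc a b) {p : ℝ} (hp : 2 ≤ p) (c : ℝ) :
    HasDerivAt (fun y => ∫ x, |x - y| ^ p ∂P) (∫ x, -(p * signedPower p c x) ∂P) c := by
  refine (hasDerivAt_integral_of_dominated_loc_of_deriv_le (Metric.ball_mem_nhds c one_pos)
    (F' := fun y x => -(p * signedPower p y x))
    -- The `+ 1` is the radius of the ball in which `y` varies.
    (bound := fun x => p * ((|x - c| + 1) * (|x - c| + 1) ^ (p - 2)))
    (Filter.Eventually.of_forall fun y =>
      (continuous_abs_sub_rpow (by linarith) y).aestronglyMeasurable)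
    (integrable_of_continuous_of_ae_mem_Icc hP (continuous_abs_sub_rpow (by linarith) c))
    ((continuous_signedPower hp c).const_mul p).neg.aestronglyMeasurable
    (Filter.Eventually.of_forall fun x y hy => ?_)
    (integrable_of_continuous_of_ae_mem_Icc hP ?_)
    (Filter.Eventually.of_forall fun x y _ => ?_)).2
  · have hxy : |x - y| ≤ |x - c| + 1 := by
      have h1 : |c - y| < 1 := by
        rw [abs_sub_comm]; exact hy
      have h2 := abs_sub_le x c y
      linarith
    rw [norm_neg, Real.norm_eq_abs, abs_mul, abs_of_nonneg (by linarith : 0 ≤ p), signedPower,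
      abs_mul, abs_of_nonneg (Real.rpow_nonneg (abs_nonneg (x - y)) (p - 2))]
    have h3 := Real.rpow_le_rpow (abs_nonneg _) hxy (sub_nonneg.2 hp)
    gcongr
  · refine continuous_const.mul (Continuous.mul (by fun_prop) ?_)
    exact Continuous.rpow_const (by fun_prop) fun _ => Or.inr (sub_nonneg.2 hp)
  · have h := (hasDerivAt_abs_rpow (x - y) (p := p) (by linarith)).comp y
      ((hasDerivAt_id y).const_sub x)
    refine HasDerivAt.congr_deriv h ?_
    rw [signedPower]
    ring

theorem SolvesQuantization.isLloydFixedPoint {P : Measure ℝ} [IsFiniteMeasure P]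
    [NullSingletonClass P] (hP0 : P ≠ 0) {a b : ℝ} (hP : ∀ᵐ x ∂P, x ∈ Set.Icc a b) {n : ℕ}
    [NeZero n] {p : ℝ} (hp : 2 ≤ p) {k : Fin n → ℝ} (hk : SolvesQuantization P p k) :
    IsLloydFixedPoint P p k := by
  refine (isLloydFixedPoint_iff hP hp k).2 fun i =>
    ⟨hk.measure_voronoiCell_ne_zero hP0 hP (by linarith) i, ?_⟩
  have hmin : IsLocalMin (fun y => ∫ x in voronoiCell k i, |x - y| ^ p ∂P) (k i) :=
    Filter.Eventually.of_forall fun y => hk.setIntegral_voronoiCell_le hP (by linarith) i y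
  have h := hmin.hasDerivAt_eq_zero
    (hasDerivAt_integral_abs_sub_rpow (ae_restrict_of_ae hP) hp (k i))
  rw [integral_neg, integral_const_mul, neg_eq_zero, mul_eq_zero] at h
  exact h.resolve_left (by linarith)

theorem mainTheorem5 (P : Measure ℝ) [IsProbabilityMeasure P] (Kbar : ℝ) (hKbar : 0 < Kbar)
    (hP : HasLogConcaveDensityOn P Kbar) (p : ℝ) (hp : 2 ≤ p) (n : ℕ) (hn : 1 ≤ n)
    (k : Fin n → ℝ) (hk : Monotone k) :
    SolvesQuantization P p k ↔ IsLloydFixedPoint P p k := by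
  obtain ⟨f, hf, hlc, hsupp, hPf⟩ := hP
  have : NeZero n := ⟨by omega⟩
  have : NullSingletonClass P := by rw [hPf]; infer_instance
  have hPIcc : ∀ᵐ x ∂P, x ∈ Set.Icc 0 Kbar := by
    rw [hPf, ae_withDensity_iff hf.ennreal_ofReal]
    refine Filter.Eventually.of_forall fun x hx => hsupp fun h => hx ?_
    rw [h, ENNReal.ofReal_zero]
  have hP0 : P ≠ 0 := IsProbabilityMeasure.ne_zero P
  refine ⟨fun h => h.isLloydFixedPoint hP0 hPIcc hp, fun h => ?_⟩
  obtain ⟨m, hm⟩ := exists_solvesQuantization (n := n) (p := p) hKbar.le hPIcc (by linarith)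
  have hmfix := hm.isLloydFixedPoint hP0 hPIcc hp
  have hkm : k = m := le_antisymm
    (hmfix.le_of_logConcave hf hlc hPf hsupp hPIcc hp hm.1 hk h)
    (h.le_of_logConcave hf hlc hPf hsupp hPIcc hp hk hm.1 hmfix)
  rwa [hkm]
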